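/- Let $\mathcal M=(\mathcal S,\mathcal A,P,r,H,\rho)$ be an episodic Markov decision process with finite state and action spaces, horizon $H\ge 2$, initial distribution $\rho$, transition functions $P_h(\cdot|s,a)$ and rewards $r_h(s,a)\in[0,1]$, $h\in[H]=\{1,\dots,H\}$. A policy $\pi=(\pi_1,\dots,\pi_H)\in\Pi$ consists of maps $\pi_h$ from states to distributions on actions. Rolling out $\pi$ gives a random trajectory $(s_1,a_1,\dots,s_H,a_H)$ with $s_1\sim\rho$, $a_h\sim\pi_h(\cdot|s_h)$, $s_{h+1}\sim P_h(\cdot|s_h,a_h)$; let $d^\pi_h(s,a)$ be the probability that $(s_h,a_h)=(s,a)$ and $V(\pi)=\mathbb E\big[\sum_{h=1}^H r_h(s_h,a_h)\big]$. Let $\pi^{\mathrm E}$ be an expert policy, and let the instance $(\mathcal M,\pi^{\mathrm E})$ be an RBAS MDP, i.e. $\mathcal S$ is the disjoint union of a set $\mathcal S^{\mathrm G}$ of good and a set $\mathcal S^{\mathrm B}$ of bad states, and there is an action $a^1$ such that for all $h\in[H]$: * for $s\in\mathcal S^{\mathrm G}$: $\pi^{\mathrm E}_h(a^1|s)=1$,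 $r_h(s,a^1)=1$, and $r_h(s,a)=0$ for $a\ne a^1$; for $s\in\mathcal S^{\mathrm B}$: $r_h(s,a)=0$ for all $a$; * for $s,s'\in\mathcal S^{\mathrm G}$: $P_h(s'|s,a^1)>0$, and $P_h(s'|s,a)=0$ for $a\neq a^1$; * for $b\in\mathcal S^{\mathrm B}$ and every action $a$: $\sum_{b'\in\mathcal S^{\mathrm B}}P_h(b'|b,a)=1$; * the expert never visits bad states: $d^{\pi^{\mathrm E}}_h(b,a)=0$ for all $b\in\mathcal S^{\mathrm B}$, $a\in\mathcal A$. Let $\mathcal D$ be a dataset of $N\ge1$ independent trajectories of $\pi^{\mathrm E}$, and let $\widehat{d}_h(s,a)$ be the fraction of the trajectories in $\mathcal D$ whose state-action pair at step $h$ is $(s,a)$. Let $\varepsilon\in\mathbb R$ and let $\bar\pi=\bar\pi(\mathcal D)$ be a policy depending on the dataset such that almost surely (over $\mathcal D$) * $\bar\pi$ is an $\varepsilon$-optimal solution of TV-AIL: $\sum_{h=1}^H\|d_h^{\bar\pi}-\widehat d_h\|_1\le\min_{\pi\in\Pi}\sum_{h=1}^H\|d_h^{\pi}-\widehat d_h\|_1+\varepsilon$,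 where $\|\cdot\|_1$ is the $\ell_1$ norm on $\mathcal S\times\mathcal A$; * for every $h\in[H]$ there is $s\in\mathcal S^{\mathrm G}$ with $\bar\pi_h(a^1|s)>0$. Define $$c(\bar\pi)=\min_{1\le\ell<h\le H,\; s,s'\in\mathcal S^{\mathrm G}}\mathbb P^{\bar\pi}\big(s_h=s\,\big|\,s_\ell=s',a_\ell=a^1\big),$$ where the probability is that of being in $s$ at step $h$ when starting from $s'$ with action $a^1$ at step $\ell$ and following $\bar\pi$ afterwards, and let $\varepsilon'=8\varepsilon/c(\bar\pi)$. Then $c(\bar\pi)>0$ almost surely, and there is a universal constant $C>0$ (independent of the MDP, of $|\mathcal S|,|\mathcal A|,H,N,\varepsilon$ and of $\bar\pi$) such that $$V(\pi^{\mathrm E})-\mathbb E\big[V(\bar\pi)\big]\;\le\; C\,\min\Big\{1+\mathbb E[\varepsilon'],\ \sqrt{\tfrac{|\mathcal S|}{N}}+\mathbb E[\varepsilon']\Big\},$$ where the expectations are over the randomness of the dataset $\mathcal D$. -/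

import Mathlib

open Finset

noncomputable section

/-- A tabular episodic MDP with finite state space `S`, finite action space `A` and horizon `H`.
Time steps are indexed by `Fin H`, so the step written `h` in `1, …, H` is the index `h - 1`. -/
structure TabularMDP (S A : Type*) [Fintype S] [Fintype A] (H : ℕ) where
  /-- initial state distribution -/
  init : S → ℝ
  init_mem : init ∈ stdSimplex ℝ S
  /-- `trans h s a s'` is the probability of moving to `s'` from `(s, a)` in step `h` -/
  trans : Fin H → S → A → S → ℝ
  trans_mem : ∀ h s a, trans h s a ∈ stdSimplex ℝ S
  /-- deterministic rewards -/
  reward : Fin H → S → A → ℝ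
  reward_mem : ∀ h s a, reward h s a ∈ Set.Icc (0 : ℝ) 1

/-- A non-stationary stochastic policy; `prob h s a` is the probability of action `a` in state `s`
at step `h`. -/
structure Policy (S A : Type*) [Fintype A] (H : ℕ) where
  prob : Fin H → S → A → ℝ
  prob_mem : ∀ h s, prob h s ∈ stdSimplex ℝ A

/-- Trajectories `(s₁, a₁, …, s_H, a_H)`. -/
abbrev Trajectory (S A : Type*) (H : ℕ) := Fin H → S × A

/-- Datasets of `N` trajectories. -/
abbrev Dataset (S A : Type*) (H N : ℕ) := Fin N → Trajectory S A H

namespace TabularMDP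

variable {S A : Type*} [Fintype S] [Fintype A] {H N : ℕ}

/-- The probability with which the environment produces the state of step `h` of `tr`, given the
earlier part of `tr`: the initial distribution in the first step, the transition function later. -/
def arrivalProb (M : TabularMDP S A H) (tr : Trajectory S A H) (h : Fin H) : ℝ :=
  if (h : ℕ) = 0 then M.init (tr h).1
  else
    M.trans ⟨h - 1, by omega⟩ (tr ⟨h - 1, by omega⟩).1 (tr ⟨h - 1, by omega⟩).2 (tr h).1

/-- The probability of a trajectory when the policy `π` is rolled out:
`ρ(s₁) π₁(a₁|s₁) ∏ P_h(s_{h+1}|s_h, a_h) π_{h+1}(a_{h+1}|s_{h+1})`. -/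
def trajProb (M : TabularMDP S A H) (π : Policy S A H) (tr : Trajectory S A H) : ℝ :=
  ∏ h : Fin H, M.arrivalProb tr h * π.prob h (tr h).1 (tr h).2

/-- The policy value: the expected sum of rewards along a trajectory. -/
def value [DecidableEq S] [DecidableEq A] (M : TabularMDP S A H) (π : Policy S A H) : ℝ :=
  ∑ tr : Trajectory S A H, M.trajProb π tr * ∑ h : Fin H, M.reward h (tr h).1 (tr h).2

/-- The state-action distribution `d_h^π(s, a)`: the probability of `(s_h, a_h) = (s, a)`. -/
def occupancy [DecidableEq S] [DecidableEq A] (M : TabularMDP S A H) (π : Policy S A H)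
    (h : Fin H) (s : S) (a : A) : ℝ :=
  ∑ tr : Trajectory S A H with tr h = (s, a), M.trajProb π tr

/-- The distribution of the state reached `k + 1` steps after taking action `a` in state `s'` at
step `ℓ`, the actions of the steps after `ℓ` being drawn from `π` (zero past the horizon). -/
def visitAfter (M : TabularMDP S A H) (π : Policy S A H) (ℓ : Fin H) (s' : S) (a : A) :
    ℕ → S → ℝ
  | 0, s => M.trans ℓ s' a s
  | k + 1, s =>
    if hk : (ℓ : ℕ) + k + 1 < H then
      ∑ x : S, ∑ b : A, M.visitAfter π ℓ s' a k x * π.prob ⟨ℓ + k + 1, hk⟩ x b *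
        M.trans ⟨ℓ + k + 1, hk⟩ x b s
    else 0

/-- The visitation probability `ℙ^π(s_h = s | s_ℓ = s', a_ℓ = a)`, for `ℓ < h`: the probability of
being in `s` at step `h` when starting from `(s', a)` at step `ℓ`. -/
def visitProb (M : TabularMDP S A H) (π : Policy S A H) (ℓ h : Fin H) (s' : S) (a : A) (s : S) :
    ℝ :=
  M.visitAfter π ℓ s' a ((h : ℕ) - ℓ - 1) s

/-- RBAS instances (reachable bad absorbing states): `good` is the set of good states, its
complement the set of bad states, `a₁` the expert action on good states and `πE` the expert. -/
structure IsRBAS [DecidableEq S] [DecidableEq A] (M : TabularMDP S A H) (πE : Policy S A H)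
    (good : Finset S) (a₁ : A) : Prop where
  expert_action : ∀ h, ∀ s ∈ good, πE.prob h s a₁ = 1
  reward_expert : ∀ h, ∀ s ∈ good, M.reward h s a₁ = 1
  reward_nonexpert : ∀ h, ∀ s ∈ good, ∀ a, a ≠ a₁ → M.reward h s a = 0
  reward_bad : ∀ h, ∀ s ∉ good, ∀ a, M.reward h s a = 0
  trans_expert : ∀ h, ∀ s ∈ good, ∀ s' ∈ good, 0 < M.trans h s a₁ s'
  trans_nonexpert : ∀ h, ∀ s ∈ good, ∀ s' ∈ good, ∀ a, a ≠ a₁ → M.trans h s a s' = 0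
  bad_absorbing : ∀ h, ∀ b ∉ good, ∀ a, ∑ b' ∈ goodᶜ, M.trans h b a b' = 1
  expert_avoids_bad : ∀ h, ∀ b ∉ good, ∀ a, M.occupancy πE h b a = 0

/-- The candidate policies: in every step the expert action has positive probability at some good
state. -/
def IsCandidate (good : Finset S) (a₁ : A) (π : Policy S A H) : Prop :=
  ∀ h, ∃ s ∈ good, 0 < π.prob h s a₁

/-- The probability of a dataset of `N` independent trajectories generated by `πE`. -/
def datasetProb (M : TabularMDP S A H) (πE : Policy S A H) (D : Dataset S A H N) : ℝ :=
  ∏ i : Fin N, M.trajProb πE (D i)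

/-- The expectation of `f(D)` over a random dataset `D` of `N` independent expert trajectories. -/
def datasetExp [DecidableEq S] [DecidableEq A] (M : TabularMDP S A H) (πE : Policy S A H)
    (f : Dataset S A H N → ℝ) : ℝ :=
  ∑ D : Dataset S A H N, M.datasetProb πE D * f D

/-- The empirical state-action distribution of step `h`. -/
def empiricalDist [DecidableEq S] [DecidableEq A] (D : Dataset S A H N) (h : Fin H) (s : S)
    (a : A) : ℝ :=
  (#{i : Fin N | D i h = (s, a)} : ℝ) / N

/-- The TV-AIL objective `∑_h ‖d_h^π - \hat d_h‖₁`. -/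
def tvLoss [DecidableEq S] [DecidableEq A] (M : TabularMDP S A H) (D : Dataset S A H N)
    (π : Policy S A H) : ℝ :=
  ∑ h : Fin H, ∑ s : S, ∑ a : A, |M.occupancy π h s a - empiricalDist D h s a|

/-- `π` is an `ε`-optimal solution of TV-AIL on the dataset `D`. -/
def IsEpsOptimal [DecidableEq S] [DecidableEq A] (M : TabularMDP S A H) (D : Dataset S A H N)
    (ε : ℝ) (π : Policy S A H) : Prop :=
  ∀ π' : Policy S A H, M.tvLoss D π ≤ M.tvLoss D π' + ε

/-- `c(π)`: the minimum of `ℙ^π(s_h = s | s_ℓ = s', a_ℓ = a₁)` over steps `ℓ < h` and good states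
`s, s'`. The set is finite, and nonempty if `2 ≤ H` and there is a good state, so that the infimum
is a minimum. -/
def minVisitProb (M : TabularMDP S A H) (good : Finset S) (a₁ : A) (π : Policy S A H) : ℝ :=
  sInf {p : ℝ | ∃ ℓ h : Fin H, ℓ < h ∧ ∃ s ∈ good, ∃ s' ∈ good, p = M.visitProb π ℓ h s' a₁ s}

end TabularMDP

end

/-! On expert data the TV-AIL objective is twice the empirical mass not covered by the policy on
good states with action `a₁` (`tvLoss_eq`). Good states are fed only by `a₁` from good states, so
the expert's occupancy dominates that of any policy there. Comparing with the expert as competitor,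
the excess uncovered mass of an `ε`-optimal policy is nonnegative at every step and totals at most
`ε / 2`.

A deviation at step `ℓ` lowers the occupancy of every good state at every later step by at least `c`
times its size (`minVisitProb_mul_le`). At each step some good state has empirical frequency at
least its expert probability, and there the deficit shows up in full in the loss. So the value lost
in all steps but the last is at most `ε / (2 c)`.

No later step reveals a deviation at the last step. Its value loss is at most the uncovered mass
there, that is, the expert's own uncovered mass plus `ε / 2`. Only this one step carries a
statistical error, hence no factor `H`; its mean is at most `1`, and at most `√(|S| / N)` by a
variance bound. -/

noncomputable section

namespace TabularMDP

set_option linter.unusedSectionVars false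

/-! ### Trajectory sums and the forward recursion for occupancies -/

/-- Marginals of a finite Markov chain given by path weights. -/
theorem sum_path_mul_eq {X : Type*} [Fintype X] (μ : X → ℝ) (K : ℕ → X → X → ℝ)
    (m : ℕ → X → ℝ) (hm0 : ∀ x, m 0 x = μ x) (n : ℕ)
    (hm : ∀ k, k < n → ∀ y, m (k + 1) y = ∑ x, m k x * K k x y)
    (hK : ∀ k, k < n → ∀ x, ∑ y, K k x y = 1) (h : Fin (n + 1)) (g : X → ℝ) :
    ∑ tr : Fin (n + 1) → X,
      (∏ i : Fin (n + 1), if (i : ℕ) = 0 then μ (tr i) else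
        K (i - 1) (tr ⟨i - 1, by omega⟩) (tr i)) * g (tr h) = ∑ x, m h x * g x := by
  induction n generalizing g with
  | zero =>
    rw [← (Equiv.funUnique (Fin 1) X).symm.sum_comp]
    obtain rfl : h = 0 := by ext; omega
    simp [hm0]
  | succ n ih =>
    have ih' := ih (fun k hk => hm k (by omega)) (fun k hk => hK k (by omega))
    rw [← (Fin.snocEquiv (fun _ : Fin (n + 2) => X)).sum_comp, Fintype.sum_prod_type, sum_comm]
    have key : ∀ (tr : Fin (n + 1) → X) (x : X),
        (∏ i : Fin (n + 1 + 1), if (i : ℕ) = 0 then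
            μ ((Fin.snocEquiv (fun _ : Fin (n + 2) => X)) (x, tr) i) else
          K (i - 1) ((Fin.snocEquiv (fun _ : Fin (n + 2) => X)) (x, tr) ⟨i - 1, by omega⟩)
            ((Fin.snocEquiv (fun _ : Fin (n + 2) => X)) (x, tr) i)) =
        (∏ i : Fin (n + 1), if (i : ℕ) = 0 then μ (tr i) else
          K (i - 1) (tr ⟨i - 1, by omega⟩) (tr i)) * K n (tr (Fin.last n)) x := by
      intro tr x
      rw [Fin.prod_univ_castSucc]
      congr 1
      · refine prod_congr rfl fun i _ => ?_
        have e1 : (Fin.snocEquiv (fun _ : Fin (n + 2) => X)) (x, tr) i.castSucc = tr i := by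
          simp [Fin.snocEquiv]
        have e2 : (Fin.snocEquiv (fun _ : Fin (n + 2) => X)) (x, tr)
            ⟨i - 1, by omega⟩ = tr ⟨i - 1, by omega⟩ :=
          Fin.snoc_castSucc (α := fun _ => X) x tr ⟨i - 1, by omega⟩
        simp only [Fin.val_castSucc, e1, e2]
      · have e1 : (Fin.snocEquiv (fun _ : Fin (n + 2) => X)) (x, tr) (Fin.last (n + 1)) = x := by
          simp [Fin.snocEquiv]
        have e2 : (Fin.snocEquiv (fun _ : Fin (n + 2) => X)) (x, tr)
            ⟨n + 1 - 1, by omega⟩ = tr (Fin.last n) :=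
          Fin.snoc_castSucc (α := fun _ => X) x tr (Fin.last n)
        simp only [Fin.val_last, e1, e2]
        simp
    simp_rw [key]
    induction h using Fin.lastCases with
    | last =>
      have e1 : ∀ (tr : Fin (n + 1) → X) (x : X),
          (Fin.snocEquiv (fun _ : Fin (n + 2) => X)) (x, tr) (Fin.last (n + 1)) = x := by
        intro tr x; simp [Fin.snocEquiv]
      simp_rw [e1]
      rw [sum_comm]
      refine sum_congr rfl fun x _ => ?_
      -- With the new endpoint `x` fixed, the last kernel factor serves as the test function of the
      -- shorter path.
      rw [← sum_mul, ih' (Fin.last n) (fun y => K n y x), Fin.val_last, Fin.val_last,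
        hm n (by omega)]
    | cast h =>
      have e1 : ∀ (tr : Fin (n + 1) → X) (x : X),
          (Fin.snocEquiv (fun _ : Fin (n + 2) => X)) (x, tr) h.castSucc = tr h := by
        intro tr x; simp [Fin.snocEquiv]
      simp_rw [e1]
      rw [Fin.val_castSucc, ← ih' h g]
      refine sum_congr rfl fun tr _ => ?_
      rw [← sum_mul, ← mul_sum, hK n (by omega), mul_one]

variable {S A : Type*} [Fintype S] [Fintype A] {H N : ℕ}

/-- The state distribution of `π` at step `h`, as a forward recursion. -/
def stateOccupancy (M : TabularMDP S A H) (π : Policy S A H) : ℕ → S → ℝ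
  | 0, s => M.init s
  | k + 1, s =>
    if hk : k < H then
      ∑ x : S, ∑ b : A, M.stateOccupancy π k x * π.prob ⟨k, hk⟩ x b * M.trans ⟨k, hk⟩ x b s
    else 0

theorem stateOccupancy_succ (M : TabularMDP S A H) (π : Policy S A H) {k : ℕ} (hk : k < H)
    (s : S) : M.stateOccupancy π (k + 1) s =
      ∑ x : S, ∑ b : A, M.stateOccupancy π k x * π.prob ⟨k, hk⟩ x b * M.trans ⟨k, hk⟩ x b s := by
  rw [stateOccupancy, dif_pos hk]

theorem stateOccupancy_nonneg (M : TabularMDP S A H) (π : Policy S A H) (k : ℕ) (s : S) :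
    0 ≤ M.stateOccupancy π k s := by
  induction k generalizing s with
  | zero => exact M.init_mem.1 s
  | succ k ih =>
    rw [stateOccupancy]
    split_ifs with hk
    · exact sum_nonneg fun x _ => sum_nonneg fun b _ =>
        mul_nonneg (mul_nonneg (ih x) ((π.prob_mem _ x).1 b)) ((M.trans_mem _ x b).1 s)
    · exact le_rfl

theorem sum_trajProb_mul (M : TabularMDP S A H) (π : Policy S A H) (h : Fin H)
    (g : S × A → ℝ) :
    ∑ tr : Trajectory S A H, M.trajProb π tr * g (tr h) =
      ∑ s : S, ∑ a : A, M.stateOccupancy π h s * π.prob h s a * g (s, a) := by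
  obtain ⟨n, rfl⟩ : ∃ n, H = n + 1 := ⟨H - 1, by have := h.2; omega⟩
  -- The chain lives on state-action pairs: one kernel step is a transition followed by the draw of
  -- the next action. The default `0` lies beyond the horizon and is never reached.
  let K : ℕ → S × A → S × A → ℝ := fun k x y =>
    if hk : k + 1 < n + 1 then M.trans ⟨k, by omega⟩ x.1 x.2 y.1 * π.prob ⟨k + 1, hk⟩ y.1 y.2
    else 0
  let m : ℕ → S × A → ℝ := fun k x =>
    if hk : k < n + 1 then M.stateOccupancy π k x.1 * π.prob ⟨k, hk⟩ x.1 x.2 else 0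
  have := sum_path_mul_eq (fun x : S × A => M.init x.1 * π.prob 0 x.1 x.2) K m
    (fun x => by simp only [m, Nat.zero_lt_succ, dif_pos]; rfl) n
    (fun k hk y => by
      simp only [m, K, Nat.succ_lt_succ_iff, hk, dif_pos, show k < n + 1 by omega,
        M.stateOccupancy_succ π (show k < n + 1 by omega), Fintype.sum_prod_type, sum_mul, mul_assoc])
    (fun k hk x => by
      simp only [K, Nat.succ_lt_succ_iff, hk, dif_pos, Fintype.sum_prod_type, ← mul_sum,
        (π.prob_mem _ _).2, mul_one]
      exact (M.trans_mem _ _ _).2) h g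
  rw [← Fintype.sum_prod_type' (f := fun s a => M.stateOccupancy π h s * π.prob h s a * g (s, a))]
  refine Eq.trans (sum_congr rfl fun tr _ => ?_) (this.trans (sum_congr rfl fun x _ => ?_))
  · congr 1
    refine prod_congr rfl fun i _ => ?_
    obtain ⟨i, hi⟩ := i
    cases i with
    | zero => simp [arrivalProb]
    | succ i => simp [arrivalProb, K, show i < n by omega]
  · simp only [m, h.2, dif_pos, Fin.eta]

theorem occupancy_eq [DecidableEq S] [DecidableEq A] (M : TabularMDP S A H) (π : Policy S A H)
    (h : Fin H) (s : S) (a : A) :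
    M.occupancy π h s a = M.stateOccupancy π h s * π.prob h s a := by
  have := M.sum_trajProb_mul π h (fun x => if x = (s, a) then 1 else 0)
  rw [occupancy, sum_filter]
  simp only [mul_ite, mul_one, mul_zero, Prod.mk.injEq] at this
  rw [this, sum_eq_single s (fun x _ hx => by simp [hx]) (by simp),
    sum_eq_single a (fun x _ hx => by simp [hx]) (by simp)]
  simp

theorem value_eq [DecidableEq S] [DecidableEq A] (M : TabularMDP S A H) (π : Policy S A H) :
    M.value π = ∑ h : Fin H, ∑ s : S, ∑ a : A,
      M.stateOccupancy π h s * π.prob h s a * M.reward h s a := by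
  simp_rw [value, mul_sum]
  rw [sum_comm]
  exact sum_congr rfl fun h _ => M.sum_trajProb_mul π h (fun x => M.reward h x.1 x.2)

theorem sum_stateOccupancy (M : TabularMDP S A H) (π : Policy S A H) {k : ℕ} (hk : k ≤ H) :
    ∑ s, M.stateOccupancy π k s = 1 := by
  induction k with
  | zero => exact M.init_mem.2
  | succ k ih =>
    simp_rw [M.stateOccupancy_succ π (show k < H by omega)]
    rw [sum_comm, ← ih (by omega)]
    refine sum_congr rfl fun x _ => ?_
    rw [sum_comm]
    simp_rw [← mul_sum, (M.trans_mem _ _ _).2, mul_one, ← mul_sum, (π.prob_mem _ _).2, mul_one]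

theorem trajProb_nonneg (M : TabularMDP S A H) (π : Policy S A H) (tr : Trajectory S A H) :
    0 ≤ M.trajProb π tr := by
  refine prod_nonneg fun h _ => mul_nonneg ?_ ((π.prob_mem _ _).1 _)
  rw [arrivalProb]
  split_ifs
  · exact M.init_mem.1 _
  · exact (M.trans_mem _ _ _).1 _

theorem sum_trajProb (M : TabularMDP S A H) (π : Policy S A H) (h : Fin H) :
    ∑ tr : Trajectory S A H, M.trajProb π tr = 1 := by
  have := M.sum_trajProb_mul π h (fun _ => 1)
  simp only [mul_one, ← mul_sum, (π.prob_mem _ _).2] at this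
  rw [this, M.sum_stateOccupancy π h.2.le]

theorem trajProb_le_occupancy [DecidableEq S] [DecidableEq A] (M : TabularMDP S A H)
    (π : Policy S A H) (tr : Trajectory S A H) (h : Fin H) :
    M.trajProb π tr ≤ M.occupancy π h (tr h).1 (tr h).2 :=
  single_le_sum (f := M.trajProb π) (fun tr _ => M.trajProb_nonneg π tr) (by simp)

/-! ### Independent samples and the empirical distribution -/

/-- The second moment of a sum of independent centred variables. -/
theorem sum_prod_mul_sq_sum {T : Type*} [Fintype T] (w Z : T → ℝ) (hw : ∑ t, w t = 1)
    (hZ : ∑ t, w t * Z t = 0) (N : ℕ) :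
    ∑ D : Fin N → T, ∏ i, w (D i) = 1 ∧
    ∑ D : Fin N → T, (∏ i, w (D i)) * ∑ i, Z (D i) = 0 ∧
    ∑ D : Fin N → T, (∏ i, w (D i)) * (∑ i, Z (D i)) ^ 2 = N * ∑ t, w t * Z t ^ 2 := by
  -- The three claims go together: expanding the square, the induction step needs the total mass and
  -- the vanishing mean of the remaining samples.
  induction N with
  | zero => simp
  | succ N ih =>
    obtain ⟨h1, h2, h3⟩ := ih
    have split : ∀ F : (Fin (N + 1) → T) → ℝ, ∑ D, F D =
        ∑ t : T, ∑ D : Fin N → T, F (Fin.cons t D) := fun F => by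
      rw [← (Fin.consEquiv (fun _ : Fin (N + 1) => T)).sum_comp, Fintype.sum_prod_type]
      rfl
    simp only [split, Fin.prod_univ_succ, Fin.sum_univ_succ, Fin.cons_zero, Fin.cons_succ]
    refine ⟨?_, ?_, ?_⟩
    · simp_rw [← mul_sum, h1, mul_one, hw]
    · have : ∀ t, ∑ D : Fin N → T, w t * (∏ i, w (D i)) * (Z t + ∑ i, Z (D i)) = w t * Z t := by
        intro t
        calc _ = w t * Z t * ∑ D : Fin N → T, ∏ i, w (D i) +
              w t * ∑ D : Fin N → T, (∏ i, w (D i)) * ∑ i, Z (D i) := by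
              rw [mul_sum, mul_sum, ← sum_add_distrib]
              exact sum_congr rfl fun D _ => by ring
          _ = _ := by rw [h1, h2]; ring
      simp_rw [this, hZ]
    · have : ∀ t, ∑ D : Fin N → T, w t * (∏ i, w (D i)) * (Z t + ∑ i, Z (D i)) ^ 2 =
          w t * Z t ^ 2 + w t * (N * ∑ t, w t * Z t ^ 2) := by
        intro t
        calc _ = w t * Z t ^ 2 * (∑ D : Fin N → T, ∏ i, w (D i)) +
              2 * w t * Z t * (∑ D : Fin N → T, (∏ i, w (D i)) * ∑ i, Z (D i)) +
              w t * ∑ D : Fin N → T, (∏ i, w (D i)) * (∑ i, Z (D i)) ^ 2 := by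
              rw [mul_sum, mul_sum, mul_sum, ← sum_add_distrib, ← sum_add_distrib]
              exact sum_congr rfl fun D _ => by ring
          _ = _ := by rw [h1, h2, h3]; ring
      simp_rw [this, sum_add_distrib, ← sum_mul, hw]
      push_cast
      ring

variable [DecidableEq S] [DecidableEq A] {M : TabularMDP S A H} {πE : Policy S A H} {good : Finset S} {a₁ : A}

theorem empiricalDist_nonneg (D : Dataset S A H N) (h : Fin H) (s : S) (a : A) :
    0 ≤ empiricalDist D h s a := by
  rw [empiricalDist]; positivity

theorem sum_empiricalDist (hN : 1 ≤ N) (D : Dataset S A H N) (h : Fin H) :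
    ∑ s, ∑ a, empiricalDist D h s a = 1 := by
  have hN' : (N : ℝ) ≠ 0 := by positivity
  simp only [empiricalDist, ← sum_div]
  rw [div_eq_one_iff_eq hN', ← Fintype.sum_prod_type'
    (f := fun s a => ((#{i : Fin N | D i h = (s, a)} : ℕ) : ℝ)), ← Nat.cast_sum,
    ← card_eq_sum_card_fiberwise (f := fun i => D i h) (by simp [Set.MapsTo])]
  simp

theorem datasetProb_nonneg (M : TabularMDP S A H) (πE : Policy S A H) (D : Dataset S A H N) :
    0 ≤ M.datasetProb πE D :=
  prod_nonneg fun i _ => M.trajProb_nonneg πE (D i)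

/-! ### Supports in an RBAS instance -/

namespace IsRBAS

theorem stateOccupancy_bad (hM : M.IsRBAS πE good a₁) (h : Fin H) {b : S} (hb : b ∉ good) :
    M.stateOccupancy πE h b = 0 := by
  have h1 : ∑ a, M.occupancy πE h b a = 0 := sum_eq_zero fun a _ => hM.expert_avoids_bad h b hb a
  simpa only [occupancy_eq, ← mul_sum, (πE.prob_mem _ _).2, mul_one] using h1

theorem sum_good_stateOccupancy (hM : M.IsRBAS πE good a₁) (h : Fin H) :
    ∑ s ∈ good, M.stateOccupancy πE h s = 1 := by
  rw [← M.sum_stateOccupancy πE h.2.le]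
  exact sum_subset (subset_univ _) fun s _ hs => hM.stateOccupancy_bad h hs

theorem prob_nonexpert (hM : M.IsRBAS πE good a₁) (h : Fin H) {s : S} (hs : s ∈ good) {a : A}
    (ha : a ≠ a₁) : πE.prob h s a = 0 := by
  have h1 := (πE.prob_mem h s).2
  rw [← add_sum_erase _ _ (mem_univ a₁), hM.expert_action h s hs, add_eq_left,
    sum_eq_zero_iff_of_nonneg fun a _ => (πE.prob_mem h s).1 a] at h1
  exact h1 a (by simp [ha])

theorem occupancy_eq_zero (hM : M.IsRBAS πE good a₁) (h : Fin H) {s : S} {a : A}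
    (hsa : ¬(s ∈ good ∧ a = a₁)) : M.occupancy πE h s a = 0 := by
  by_cases hs : s ∈ good
  · rw [occupancy_eq, hM.prob_nonexpert h hs fun ha => hsa ⟨hs, ha⟩, mul_zero]
  · exact hM.expert_avoids_bad h s hs a

/-- A trajectory through any other pair weighs no more than the expert's occupancy of that pair,
which is zero. This turns the almost sure support of the data into a pointwise fact. -/
theorem dataset_mem (hM : M.IsRBAS πE good a₁) {D : Dataset S A H N}
    (hD : 0 < M.datasetProb πE D) (i : Fin N) (h : Fin H) :
    (D i h).1 ∈ good ∧ (D i h).2 = a₁ := by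
  by_contra hc
  have h1 := M.trajProb_le_occupancy πE (D i) h
  rw [hM.occupancy_eq_zero h hc] at h1
  exact hD.ne' (prod_eq_zero (mem_univ i) (le_antisymm h1 (M.trajProb_nonneg πE _)))

theorem empiricalDist_eq_zero (hM : M.IsRBAS πE good a₁) {D : Dataset S A H N}
    (hD : 0 < M.datasetProb πE D) (h : Fin H) {s : S} {a : A} (hsa : ¬(s ∈ good ∧ a = a₁)) :
    empiricalDist D h s a = 0 := by
  rw [empiricalDist, filter_false_of_mem, card_empty, Nat.cast_zero, zero_div]
  rintro i - hi
  have := hM.dataset_mem hD i h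
  rw [hi] at this
  exact hsa this

theorem sum_eq_sum_good {f : S → A → ℝ} (hf : ∀ s a, ¬(s ∈ good ∧ a = a₁) → f s a = 0) :
    ∑ s, ∑ a, f s a = ∑ s ∈ good, f s a₁ := by
  rw [← sum_subset (subset_univ good)
    fun s _ hs => sum_eq_zero fun a _ => hf s a fun hc => hs hc.1]
  exact sum_congr rfl fun s _ => sum_eq_single a₁
    (fun a _ ha => hf s a fun hc => ha hc.2) (by simp)

theorem sum_good_empiricalDist (hM : M.IsRBAS πE good a₁) (hN : 1 ≤ N) {D : Dataset S A H N}
    (hD : 0 < M.datasetProb πE D) (h : Fin H) : ∑ s ∈ good, empiricalDist D h s a₁ = 1 := by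
  rw [← sum_empiricalDist hN D h]
  exact (sum_eq_sum_good fun s a hsa => hM.empiricalDist_eq_zero hD h hsa).symm

/-- On expert data the TV-AIL objective is twice the uncovered empirical mass. -/
theorem tvLoss_eq (hM : M.IsRBAS πE good a₁) (hN : 1 ≤ N) {D : Dataset S A H N}
    (hD : 0 < M.datasetProb πE D) (π : Policy S A H) :
    M.tvLoss D π = 2 * ∑ h : Fin H, ∑ s ∈ good,
      max (empiricalDist D h s a₁ - M.stateOccupancy π h s * π.prob h s a₁) 0 := by
  rw [tvLoss, mul_sum]
  refine sum_congr rfl fun h _ => ?_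
  have hnn : ∀ s a, 0 ≤ M.stateOccupancy π h s * π.prob h s a := fun s a =>
    mul_nonneg (M.stateOccupancy_nonneg π h s) ((π.prob_mem h s).1 a)
  rw [← sum_eq_sum_good (a₁ := a₁) (f := fun s a =>
    max (empiricalDist D h s a - M.stateOccupancy π h s * π.prob h s a) 0)]
  -- The linear part of `|x - y| = 2 max (y - x) 0 + x - y` cancels in the sum, both distributions
  -- having mass one.
  · have h1 : ∀ s a, |M.occupancy π h s a - empiricalDist D h s a| =
        2 * max (empiricalDist D h s a - M.stateOccupancy π h s * π.prob h s a) 0 +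
          M.stateOccupancy π h s * π.prob h s a - empiricalDist D h s a := by
      intro s a
      rw [occupancy_eq]
      rcases le_total (empiricalDist D h s a) (M.stateOccupancy π h s * π.prob h s a) with hc | hc
      · rw [abs_of_nonneg (by linarith), max_eq_right (by linarith)]; ring
      · rw [abs_of_nonpos (by linarith), max_eq_left (by linarith)]; ring
    simp_rw [h1, sum_sub_distrib, sum_add_distrib, sum_empiricalDist hN, ← mul_sum,
      (π.prob_mem h _).2, mul_one, M.sum_stateOccupancy π h.2.le]
    ring
  · intro s a hsa
    rw [hM.empiricalDist_eq_zero hD h hsa, max_eq_right]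
    linarith [hnn s a]

theorem value_eq_sum_good (hM : M.IsRBAS πE good a₁) (π : Policy S A H) :
    M.value π = ∑ h : Fin H, ∑ s ∈ good, M.stateOccupancy π h s * π.prob h s a₁ := by
  rw [value_eq]
  refine sum_congr rfl fun h _ => ?_
  rw [sum_eq_sum_good (good := good) (a₁ := a₁)]
  · exact sum_congr rfl fun s hs => by rw [hM.reward_expert h s hs, mul_one]
  · intro s a hsa
    by_cases hs : s ∈ good
    · rw [hM.reward_nonexpert h s hs a fun ha => hsa ⟨hs, ha⟩, mul_zero]
    · rw [hM.reward_bad h s hs, mul_zero]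

/-- From a bad state the transitions to bad states already exhaust the mass. The occupancy
recursions therefore close up on `good` with the single action `a₁`. -/
theorem trans_good_eq_zero (hM : M.IsRBAS πE good a₁) (h : Fin H) {s : S} (hs : s ∈ good)
    (x : S) (a : A) (hxa : ¬(x ∈ good ∧ a = a₁)) : M.trans h x a s = 0 := by
  by_cases hx : x ∈ good
  · exact hM.trans_nonexpert h x hx s hs a fun ha => hxa ⟨hx, ha⟩
  · have h1 := (M.trans_mem h x a).2
    rw [← sum_add_sum_compl good, hM.bad_absorbing h x hx, add_eq_right,
      sum_eq_zero_iff_of_nonneg fun s _ => (M.trans_mem h x a).1 s] at h1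
    exact h1 s hs

theorem stateOccupancy_succ_good (hM : M.IsRBAS πE good a₁) (π : Policy S A H) {k : ℕ}
    (hk : k < H) {s : S} (hs : s ∈ good) : M.stateOccupancy π (k + 1) s = ∑ x ∈ good,
      M.stateOccupancy π k x * π.prob ⟨k, hk⟩ x a₁ * M.trans ⟨k, hk⟩ x a₁ s := by
  rw [M.stateOccupancy_succ π hk]
  exact sum_eq_sum_good fun x a hxa => by rw [hM.trans_good_eq_zero _ hs x a hxa, mul_zero]

/-! ### Visitation probabilities and the constant `c` -/

theorem visitAfter_succ_good (hM : M.IsRBAS πE good a₁) (π : Policy S A H) (ℓ : Fin H) (s' : S)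
    {k : ℕ} (hk : (ℓ : ℕ) + k + 1 < H) {s : S} (hs : s ∈ good) :
    M.visitAfter π ℓ s' a₁ (k + 1) s = ∑ x ∈ good, M.visitAfter π ℓ s' a₁ k x *
      π.prob ⟨ℓ + k + 1, hk⟩ x a₁ * M.trans ⟨ℓ + k + 1, hk⟩ x a₁ s := by
  rw [visitAfter, dif_pos hk]
  exact sum_eq_sum_good fun x a hxa => by rw [hM.trans_good_eq_zero _ hs x a hxa, mul_zero]

/-- One good state per step with positive probability of `a₁` suffices, since `a₁` leads from every
good state to every good state with positive probability. -/
theorem visitAfter_pos (hM : M.IsRBAS πE good a₁) {π : Policy S A H}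
    (hπ : IsCandidate good a₁ π) (ℓ : Fin H) {s' : S} (hs' : s' ∈ good) (k : ℕ)
    (hk : (ℓ : ℕ) + k < H) {s : S} (hs : s ∈ good) : 0 < M.visitAfter π ℓ s' a₁ k s := by
  induction k generalizing s with
  | zero => exact hM.trans_expert ℓ s' hs' s hs
  | succ k ih =>
    rw [hM.visitAfter_succ_good π ℓ s' (by omega) hs]
    obtain ⟨x, hx, hpx⟩ := hπ ⟨ℓ + k + 1, by omega⟩
    refine sum_pos' (fun y hy => ?_) ⟨x, hx, ?_⟩
    · exact mul_nonneg (mul_nonneg (ih (by omega) hy).le ((π.prob_mem _ _).1 _))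
        (hM.trans_expert _ y hy s hs).le
    · exact mul_pos (mul_pos (ih (by omega) hx) hpx) (hM.trans_expert _ x hx s hs)

theorem good_nonempty (hM : M.IsRBAS πE good a₁) (hH : 2 ≤ H) : good.Nonempty := by
  have := hM.sum_good_stateOccupancy ⟨0, by omega⟩
  by_contra hc
  rw [not_nonempty_iff_eq_empty.1 hc, sum_empty] at this
  exact zero_ne_one this

theorem finite_visitProbs (M : TabularMDP S A H) (good : Finset S) (a₁ : A) (π : Policy S A H) :
    {p : ℝ | ∃ ℓ h : Fin H, ℓ < h ∧ ∃ s ∈ good, ∃ s' ∈ good,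
      p = M.visitProb π ℓ h s' a₁ s}.Finite :=
  (Set.finite_range fun x : Fin H × Fin H × S × S =>
    M.visitProb π x.1 x.2.1 x.2.2.2 a₁ x.2.2.1).subset <| by
      rintro p ⟨ℓ, h, -, s, -, s', -, rfl⟩
      exact ⟨(ℓ, h, s, s'), rfl⟩

theorem minVisitProb_le (M : TabularMDP S A H) (a₁ : A) (π : Policy S A H) {ℓ h : Fin H}
    (hℓ : ℓ < h) {s s' : S} (hs : s ∈ good) (hs' : s' ∈ good) :
    M.minVisitProb good a₁ π ≤ M.visitProb π ℓ h s' a₁ s :=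
  csInf_le (finite_visitProbs M good a₁ π).bddBelow ⟨ℓ, h, hℓ, s, hs, s', hs', rfl⟩

theorem minVisitProb_pos (hM : M.IsRBAS πE good a₁) (hH : 2 ≤ H) {π : Policy S A H}
    (hπ : IsCandidate good a₁ π) : 0 < M.minVisitProb good a₁ π := by
  obtain ⟨s, hs⟩ := hM.good_nonempty hH
  have hne : {p : ℝ | ∃ ℓ h : Fin H, ℓ < h ∧ ∃ s ∈ good, ∃ s' ∈ good,
      p = M.visitProb π ℓ h s' a₁ s}.Nonempty :=
    ⟨_, ⟨0, by omega⟩, ⟨1, by omega⟩, by simp, s, hs, s, hs, rfl⟩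
  obtain ⟨ℓ, h, hℓ, s, hs, s', hs', hp⟩ := hne.csInf_mem (finite_visitProbs M good a₁ π)
  rw [minVisitProb, hp]
  have hℓ' : (ℓ : ℕ) < h := hℓ
  exact hM.visitAfter_pos hπ ℓ hs' _ (by omega) hs

/-- Allows the last step's `ε / 2` to be absorbed into a multiple of `ε / c`. -/
theorem minVisitProb_le_one (hM : M.IsRBAS πE good a₁) (hH : 2 ≤ H) (π : Policy S A H) :
    M.minVisitProb good a₁ π ≤ 1 := by
  obtain ⟨s, hs⟩ := hM.good_nonempty hH
  have h1 : (⟨0, by omega⟩ : Fin H) < ⟨1, by omega⟩ := by simp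
  refine (minVisitProb_le M a₁ π h1 hs hs).trans ?_
  rw [← (M.trans_mem ⟨0, by omega⟩ s a₁).2]
  exact single_le_sum (f := M.trans ⟨0, by omega⟩ s a₁)
    (fun x _ => (M.trans_mem _ s a₁).1 x) (mem_univ s)

theorem prob_le_one (π : Policy S A H) (h : Fin H) (s : S) (a : A) : π.prob h s a ≤ 1 := by
  rw [← (π.prob_mem h s).2]
  exact single_le_sum (f := π.prob h s) (fun x _ => (π.prob_mem h s).1 x) (mem_univ a)

/-! ### Deviations from the expert and their effect on occupancies -/

theorem expert_stateOccupancy_succ (hM : M.IsRBAS πE good a₁) {k : ℕ}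
    (hk : k < H) {s : S} (hs : s ∈ good) : M.stateOccupancy πE (k + 1) s = ∑ x ∈ good,
      M.stateOccupancy πE k x * M.trans ⟨k, hk⟩ x a₁ s := by
  rw [hM.stateOccupancy_succ_good πE hk hs]
  exact sum_congr rfl fun x hx => by rw [hM.expert_action _ x hx, mul_one]

/-- Expert probability of being where `π` would leave the expert action in step `ℓ`. -/
def deviation (M : TabularMDP S A H) (πE π : Policy S A H) (good : Finset S) (a₁ : A)
    (ℓ : Fin H) : ℝ :=
  ∑ s ∈ good, M.stateOccupancy πE ℓ s * (1 - π.prob ℓ s a₁)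

theorem filter_lt_succ {h : ℕ} (hh : h < H) :
    ({ℓ : Fin H | (ℓ : ℕ) < h + 1} : Finset (Fin H)) =
      insert ⟨h, hh⟩ ({ℓ : Fin H | (ℓ : ℕ) < h} : Finset (Fin H)) := by
  ext ℓ
  simp only [mem_filter, mem_univ, true_and, mem_insert, Fin.ext_iff]
  omega

/-- Performance-difference identity on good states. -/
theorem stateOccupancy_sub (hM : M.IsRBAS πE good a₁) (π : Policy S A H) (h : ℕ) (hh : h < H)
    {s : S} (hs : s ∈ good) :
    M.stateOccupancy πE h s - M.stateOccupancy π h s =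
      ∑ ℓ ∈ univ.filter (fun ℓ : Fin H => (ℓ : ℕ) < h), ∑ s' ∈ good,
        M.stateOccupancy πE ℓ s' * (1 - π.prob ℓ s' a₁) *
          M.visitAfter π ℓ s' a₁ (h - ℓ - 1) s := by
  induction h generalizing s with
  | zero => simp [stateOccupancy]
  | succ h ih =>
    have hh' : h < H := by omega
    rw [hM.expert_stateOccupancy_succ hh' hs, hM.stateOccupancy_succ_good π hh' hs,
      filter_lt_succ hh', sum_insert (by simp), ← sum_sub_distrib]
    -- The new difference is a fresh deviation at step `h` plus the old difference propagated by
    -- `π`; the latter lengthens each `visitAfter` by one step.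
    have e : ∀ x ∈ good, M.stateOccupancy πE h x * M.trans ⟨h, hh'⟩ x a₁ s -
        M.stateOccupancy π h x * π.prob ⟨h, hh'⟩ x a₁ * M.trans ⟨h, hh'⟩ x a₁ s =
        M.stateOccupancy πE h x * (1 - π.prob ⟨h, hh'⟩ x a₁) * M.trans ⟨h, hh'⟩ x a₁ s +
        (∑ ℓ ∈ univ.filter (fun ℓ : Fin H => (ℓ : ℕ) < h), ∑ s' ∈ good,
          M.stateOccupancy πE ℓ s' * (1 - π.prob ℓ s' a₁) *
          M.visitAfter π ℓ s' a₁ (h - ℓ - 1) x) *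
          (π.prob ⟨h, hh'⟩ x a₁ * M.trans ⟨h, hh'⟩ x a₁ s) := fun x hx => by
      rw [← ih hh' hx]; ring
    rw [sum_congr rfl e, sum_add_distrib]
    congr 1
    · refine sum_congr rfl fun x _ => ?_
      have : h + 1 - h - 1 = 0 := by omega
      rw [show h + 1 - ((⟨h, hh'⟩ : Fin H) : ℕ) - 1 = 0 from this]
      rfl
    · simp_rw [sum_mul]
      rw [sum_comm]
      refine sum_congr rfl fun ℓ hℓ => ?_
      have hℓ' : (ℓ : ℕ) < h := by simpa using hℓ
      rw [sum_comm]
      refine sum_congr rfl fun s' _ => ?_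
      have e1 : h + 1 - (ℓ : ℕ) - 1 = (h - ℓ - 1) + 1 := by omega
      have e2 : (ℓ : ℕ) + (h - ℓ - 1) + 1 = h := by omega
      rw [e1, hM.visitAfter_succ_good π ℓ s' (by omega) hs, mul_sum]
      refine sum_congr rfl fun x _ => ?_
      simp only [e2]
      ring

/-- In the difference identity every visitation probability is at least `c` and all weights are
nonnegative. The bound holds at each good state, so a single well-chosen state can witness all
earlier deviations. -/
theorem minVisitProb_mul_le (hM : M.IsRBAS πE good a₁) (π : Policy S A H) (h : Fin H)
    {s : S} (hs : s ∈ good) :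
    M.minVisitProb good a₁ π * ∑ ℓ ∈ univ.filter (fun ℓ : Fin H => (ℓ : ℕ) < h), deviation M πE π good a₁ ℓ ≤
      M.stateOccupancy πE h s - M.stateOccupancy π h s := by
  rw [hM.stateOccupancy_sub π h h.2 hs, mul_sum]
  refine sum_le_sum fun ℓ hℓ => ?_
  rw [deviation, mul_sum]
  refine sum_le_sum fun s' hs' => ?_
  rw [mul_comm]
  exact mul_le_mul_of_nonneg_left
    (minVisitProb_le M a₁ π (Fin.lt_def.2 (by simpa using hℓ)) hs hs')
    (mul_nonneg (M.stateOccupancy_nonneg _ _ _) (sub_nonneg.2 (prob_le_one π ℓ s' a₁)))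

/-- Only `a₁` keeps mass on good states, and the expert always plays it there. -/
theorem stateOccupancy_le (hM : M.IsRBAS πE good a₁) (π : Policy S A H) {h : ℕ} (hh : h < H)
    {s : S} (hs : s ∈ good) : M.stateOccupancy π h s ≤ M.stateOccupancy πE h s := by
  induction h generalizing s with
  | zero => exact le_rfl
  | succ h ih =>
    rw [hM.expert_stateOccupancy_succ (by omega) hs, hM.stateOccupancy_succ_good π (by omega) hs]
    exact sum_le_sum fun x hx => mul_le_mul_of_nonneg_right
      ((mul_le_of_le_one_right (M.stateOccupancy_nonneg _ _ _) (prob_le_one _ _ _ _)).trans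
        (ih (by omega) hx)) ((M.trans_mem _ _ _).1 _)

theorem stateOccupancy_mul_le (hM : M.IsRBAS πE good a₁) (π : Policy S A H) (h : Fin H)
    {s : S} (hs : s ∈ good) :
    M.stateOccupancy π h s * π.prob h s a₁ ≤ M.stateOccupancy πE h s :=
  (mul_le_of_le_one_right (M.stateOccupancy_nonneg _ _ _) (prob_le_one _ _ _ _)).trans
    (hM.stateOccupancy_le π h.2 hs)

/-- A union bound over the first step that leaves the expert action: each step adds at most its
deviation, and transitions do not increase the mass already lost. -/
theorem sum_stateOccupancy_sub_le (hM : M.IsRBAS πE good a₁) (π : Policy S A H) (h : ℕ)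
    (hh : h < H) :
    ∑ s ∈ good, (M.stateOccupancy πE h s - M.stateOccupancy π h s * π.prob ⟨h, hh⟩ s a₁) ≤
      ∑ ℓ ∈ univ.filter (fun ℓ : Fin H => (ℓ : ℕ) < h + 1), deviation M πE π good a₁ ℓ := by
  have step : ∑ s ∈ good, (M.stateOccupancy πE h s -
      M.stateOccupancy π h s * π.prob ⟨h, hh⟩ s a₁) ≤ deviation M πE π good a₁ ⟨h, hh⟩ +
      ∑ s ∈ good, (M.stateOccupancy πE h s - M.stateOccupancy π h s) := by
    rw [deviation, ← sum_add_distrib]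
    refine sum_le_sum fun s hs => ?_
    have h1 := hM.stateOccupancy_le π hh hs
    have h2 := prob_le_one π ⟨h, hh⟩ s a₁
    dsimp only
    nlinarith
  refine step.trans ?_
  rw [filter_lt_succ hh, sum_insert (by simp)]
  refine add_le_add le_rfl ?_
  cases h with
  | zero => simp [stateOccupancy]
  | succ h =>
    refine le_trans ?_ (sum_stateOccupancy_sub_le hM π h (by omega))
    have e : ∀ s ∈ good, M.stateOccupancy πE (h + 1) s - M.stateOccupancy π (h + 1) s =
        ∑ x ∈ good, (M.stateOccupancy πE h x - M.stateOccupancy π h x *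
          π.prob ⟨h, by omega⟩ x a₁) * M.trans ⟨h, by omega⟩ x a₁ s := fun s hs => by
      rw [hM.expert_stateOccupancy_succ (by omega) hs,
        hM.stateOccupancy_succ_good π (by omega) hs, ← sum_sub_distrib]
      exact sum_congr rfl fun x _ => by ring
    rw [sum_congr rfl e, sum_comm]
    refine sum_le_sum fun x hx => ?_
    rw [← mul_sum]
    refine mul_le_of_le_one_right
      (sub_nonneg.2 (hM.stateOccupancy_mul_le π ⟨h, by omega⟩ hx)) ?_
    rw [← (M.trans_mem ⟨h, by omega⟩ x a₁).2]
    exact sum_le_sum_of_subset_of_nonneg (subset_univ _) fun s _ _ => (M.trans_mem _ _ _).1 s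

/-! ### The value gap for a fixed dataset -/

/-- Gap between the value of the expert and an `ε`-optimal candidate for a fixed dataset. -/
theorem value_sub_le (hM : M.IsRBAS πE good a₁) (hH : 2 ≤ H) (hN : 1 ≤ N) {D : Dataset S A H N}
    (hD : 0 < M.datasetProb πE D) {ε : ℝ} {π : Policy S A H} (hπ : IsCandidate good a₁ π)
    (hopt : M.IsEpsOptimal D ε π) :
    M.value πE - M.value π ≤ ∑ s ∈ good, max (empiricalDist D ⟨H - 1, by omega⟩ s a₁ -
      M.stateOccupancy πE (H - 1) s) 0 + 8 * ε / M.minVisitProb good a₁ π := by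
  obtain ⟨n, rfl⟩ : ∃ n, H = n + 1 := ⟨H - 1, by omega⟩
  set c := M.minVisitProb good a₁ π with hc
  have hc0 : 0 < c := hM.minVisitProb_pos hH hπ
  have hc1 : c ≤ 1 := hM.minVisitProb_le_one hH π
  -- `F` and `E` are the uncovered masses of `π` and of the expert, and `G` is the value lost at
  -- each step.
  let F : Fin (n + 1) → ℝ := fun h => ∑ s ∈ good,
    max (empiricalDist D h s a₁ - M.stateOccupancy π h s * π.prob h s a₁) 0
  let E : Fin (n + 1) → ℝ := fun h => ∑ s ∈ good,
    max (empiricalDist D h s a₁ - M.stateOccupancy πE h s) 0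
  let G : Fin (n + 1) → ℝ := fun h => ∑ s ∈ good,
    (M.stateOccupancy πE h s - M.stateOccupancy π h s * π.prob h s a₁)
  have hterm : ∀ h : Fin (n + 1), ∀ s ∈ good,
      max (empiricalDist D h s a₁ - M.stateOccupancy πE h s) 0 ≤
      max (empiricalDist D h s a₁ - M.stateOccupancy π h s * π.prob h s a₁) 0 := fun h s hs =>
    max_le_max (sub_le_sub_left (hM.stateOccupancy_mul_le π h hs) _) le_rfl
  have hEF : ∀ h, E h ≤ F h := fun h => sum_le_sum (hterm h)
  have hsum : ∑ h, (F h - E h) ≤ ε / 2 := by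
    have h1 := hopt πE
    rw [hM.tvLoss_eq hN hD, hM.tvLoss_eq hN hD] at h1
    have h2 : ∑ h : Fin (n + 1), ∑ s ∈ good, max (empiricalDist D h s a₁ -
        M.stateOccupancy πE h s * πE.prob h s a₁) 0 = ∑ h, E h :=
      sum_congr rfl fun h _ => sum_congr rfl fun s hs => by
        rw [hM.expert_action h s hs, mul_one]
    rw [h2] at h1
    rw [sum_sub_distrib]
    linarith
  have hε : 0 ≤ ε := by
    have : 0 ≤ ∑ h, (F h - E h) := sum_nonneg fun h _ => sub_nonneg.2 (hEF h)
    linarith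
  have hsucc : ∀ h : Fin n, c * G h.castSucc ≤ F h.succ - E h.succ := by
    intro h
    -- Both vectors have mass one on `good`, so such a state exists. There both positive parts are
    -- active, and their difference is the full occupancy gap.
    obtain ⟨s, hs, hle⟩ : ∃ s ∈ good,
        M.stateOccupancy πE h.succ s ≤ empiricalDist D h.succ s a₁ :=
      exists_le_of_sum_le (hM.good_nonempty hH) <| by
        rw [hM.sum_good_stateOccupancy, hM.sum_good_empiricalDist hN hD]
    have h1 := mul_le_mul_of_nonneg_left
      (hM.sum_stateOccupancy_sub_le π h (by omega)) hc0.le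
    have h2 := hM.minVisitProb_mul_le π h.succ hs
    have h3 : M.stateOccupancy πE h.succ s - M.stateOccupancy π h.succ s ≤
        max (empiricalDist D h.succ s a₁ - M.stateOccupancy π h.succ s * π.prob h.succ s a₁) 0 -
        max (empiricalDist D h.succ s a₁ - M.stateOccupancy πE h.succ s) 0 := by
      rw [max_eq_left (sub_nonneg.2 hle), max_eq_left (sub_nonneg.2
        ((hM.stateOccupancy_mul_le π h.succ hs).trans hle))]
      have := mul_le_of_le_one_right (M.stateOccupancy_nonneg π h.succ s)
        (prob_le_one π h.succ s a₁)
      linarith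
    have h4 := single_le_sum (f := fun s =>
        max (empiricalDist D h.succ s a₁ - M.stateOccupancy π h.succ s * π.prob h.succ s a₁) 0 -
        max (empiricalDist D h.succ s a₁ - M.stateOccupancy πE h.succ s) 0)
      (fun s hs => sub_nonneg.2 (hterm h.succ s hs)) hs
    rw [sum_sub_distrib] at h4
    exact h1.trans (h2.trans (h3.trans h4))
  have hlast : G (Fin.last n) ≤ F (Fin.last n) := by
    -- Equal total mass lets the empirical distribution replace the expert's inside the sum.
    have h1 : G (Fin.last n) = ∑ s ∈ good, (empiricalDist D (Fin.last n) s a₁ -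
        M.stateOccupancy π (Fin.last n) s * π.prob (Fin.last n) s a₁) := by
      simp only [G]
      rw [sum_sub_distrib, sum_sub_distrib, hM.sum_good_stateOccupancy,
        hM.sum_good_empiricalDist hN hD]
    rw [h1]
    exact sum_le_sum fun s _ => le_max_left _ _
  have hlast' : F (Fin.last n) - E (Fin.last n) ≤ ε / 2 :=
    (single_le_sum (f := fun h => F h - E h) (fun h _ => sub_nonneg.2 (hEF h))
      (mem_univ (Fin.last n))).trans hsum
  have hfirst : c * ∑ h : Fin n, G h.castSucc ≤ ε / 2 := by
    refine le_trans ?_ hsum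
    rw [Fin.sum_univ_succ, mul_sum]
    exact (sum_le_sum fun h _ => hsucc h).trans
      (le_add_of_nonneg_left (sub_nonneg.2 (hEF 0)))
  have hval : M.value πE - M.value π = ∑ h, G h := by
    rw [hM.value_eq_sum_good, hM.value_eq_sum_good, ← sum_sub_distrib]
    refine sum_congr rfl fun h _ => ?_
    rw [← sum_sub_distrib]
    exact sum_congr rfl fun s hs => by rw [hM.expert_action h s hs, mul_one]
  rw [hval, Fin.sum_univ_castSucc]
  -- As `c ≤ 1`, the left side is at most `ε / (2 c) + ε / 2 ≤ ε / c`; the factor `8` is slack.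
  have hdiv : ∑ h : Fin n, G h.castSucc + ε / 2 ≤ 8 * ε / c := by
    rw [le_div_iff₀ hc0]
    nlinarith
  change _ ≤ E (Fin.last n) + _
  linarith

end IsRBAS

/-! ### Averaging over the dataset -/

theorem sum_datasetProb (M : TabularMDP S A H) (πE : Policy S A H) (h : Fin H) :
    ∑ D : Dataset S A H N, M.datasetProb πE D = 1 :=
  (sum_prod_mul_sq_sum (M.trajProb πE) 0 (M.sum_trajProb πE h) (by simp) N).1

/-- The variance of an empirical frequency. -/
theorem datasetExp_empiricalDist_sub_sq_le (hN : 1 ≤ N) (M : TabularMDP S A H)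
    (πE : Policy S A H) (h : Fin H) (s : S) (a : A) :
    M.datasetExp πE (fun D : Dataset S A H N =>
      (empiricalDist D h s a - M.occupancy πE h s a) ^ 2) ≤ M.occupancy πE h s a / N := by
  have hN' : (0 : ℝ) < N := by positivity
  set q := M.occupancy πE h s a with hq
  let Z : Trajectory S A H → ℝ := fun tr => (if tr h = (s, a) then 1 else 0) - q
  have hw := M.sum_trajProb πE h
  have hind : ∑ tr : Trajectory S A H,
      M.trajProb πE tr * (if tr h = (s, a) then (1 : ℝ) else 0) = q := by
    rw [hq, occupancy, sum_filter]
    simp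
  have hZ : ∑ tr, M.trajProb πE tr * Z tr = 0 := by
    simp only [Z, mul_sub, sum_sub_distrib, hind, ← sum_mul, hw, one_mul, sub_self]
  -- Bernoulli variance: the sum equals `q - q ^ 2`.
  have hZ2 : ∑ tr, M.trajProb πE tr * Z tr ^ 2 ≤ q := by
    have : ∀ tr, M.trajProb πE tr * Z tr ^ 2 =
        (1 - 2 * q) * (M.trajProb πE tr * (if tr h = (s, a) then (1 : ℝ) else 0)) +
          M.trajProb πE tr * q ^ 2 := fun tr => by
      simp only [Z]; split_ifs <;> ring
    simp_rw [this, sum_add_distrib, ← mul_sum, ← sum_mul, hind, hw]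
    nlinarith [sq_nonneg q]
  have hemp : ∀ D : Dataset S A H N, empiricalDist D h s a - q = (∑ i, Z (D i)) / N := by
    intro D
    simp only [Z, empiricalDist, sum_sub_distrib, sum_boole, sum_const, card_univ,
      Fintype.card_fin, nsmul_eq_mul]
    field_simp
  have h3 := (sum_prod_mul_sq_sum (M.trajProb πE) Z hw hZ N).2.2
  have : M.datasetExp πE (fun D : Dataset S A H N => (empiricalDist D h s a - q) ^ 2) =
      (N * ∑ tr, M.trajProb πE tr * Z tr ^ 2) / N ^ 2 := by
    rw [← h3, datasetExp, sum_div]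
    exact sum_congr rfl fun D _ => by rw [hemp, datasetProb, div_pow, mul_div_assoc]
  rw [this, pow_two, mul_div_mul_left _ _ hN'.ne']
  gcongr

/-- Jensen for the square, from nonnegativity of the variance. -/
theorem sq_datasetExp_le (M : TabularMDP S A H) (πE : Policy S A H) (h : Fin H)
    (f : Dataset S A H N → ℝ) :
    (M.datasetExp πE f) ^ 2 ≤ M.datasetExp πE (fun D => f D ^ 2) := by
  set m := M.datasetExp πE f with hm
  have h1 : 0 ≤ ∑ D : Dataset S A H N, M.datasetProb πE D * (f D - m) ^ 2 :=
    sum_nonneg fun D _ => mul_nonneg (datasetProb_nonneg M πE D) (sq_nonneg _)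
  have h2 : ∀ D : Dataset S A H N, M.datasetProb πE D * (f D - m) ^ 2 =
      M.datasetProb πE D * f D ^ 2 - 2 * m * (M.datasetProb πE D * f D) +
        M.datasetProb πE D * m ^ 2 := fun D => by ring
  simp_rw [h2, sum_add_distrib, sum_sub_distrib, ← mul_sum, ← sum_mul,
    M.sum_datasetProb πE h] at h1
  rw [datasetExp] at hm
  rw [← hm] at h1
  rw [datasetExp]
  linarith

/-- Datasets of probability zero contribute nothing, so an almost sure inequality is enough. -/
theorem datasetExp_mono {f g : Dataset S A H N → ℝ}
    (hfg : ∀ D, 0 < M.datasetProb πE D → f D ≤ g D) :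
    M.datasetExp πE f ≤ M.datasetExp πE g := by
  refine sum_le_sum fun D _ => ?_
  rcases (datasetProb_nonneg M πE D).eq_or_lt' with h0 | h0
  · simp [h0]
  · exact mul_le_mul_of_nonneg_left (hfg D h0) h0.le

namespace IsRBAS

/-- Jensen, then Cauchy–Schwarz over the good states. The variances are at most `1 / N` times
occupancies that sum to one, so only the factor `|S|` remains. -/
theorem datasetExp_sum_max_le_sqrt (hM : M.IsRBAS πE good a₁) (hN : 1 ≤ N) (h : Fin H) :
    M.datasetExp πE (fun D : Dataset S A H N =>
      ∑ s ∈ good, max (empiricalDist D h s a₁ - M.stateOccupancy πE h s) 0) ≤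
      √((Fintype.card S : ℝ) / N) := by
  have hN' : (0 : ℝ) < N := by positivity
  refine Real.le_sqrt_of_sq_le ((sq_datasetExp_le M πE h _).trans ?_)
  have hocc : ∀ s ∈ good, M.occupancy πE h s a₁ = M.stateOccupancy πE h s := fun s hs => by
    rw [occupancy_eq, hM.expert_action h s hs, mul_one]
  have h1 : ∀ D : Dataset S A H N,
      (∑ s ∈ good, max (empiricalDist D h s a₁ - M.stateOccupancy πE h s) 0) ^ 2 ≤
      Fintype.card S * ∑ s ∈ good, (empiricalDist D h s a₁ - M.occupancy πE h s a₁) ^ 2 := by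
    intro D
    refine sq_sum_le_card_mul_sum_sq.trans ?_
    refine mul_le_mul (by exact_mod_cast card_le_univ good) (sum_le_sum fun s hs => ?_)
      (sum_nonneg fun s _ => sq_nonneg _) (Nat.cast_nonneg _)
    rw [hocc s hs]
    rcases le_total (empiricalDist D h s a₁ - M.stateOccupancy πE h s) 0 with hc | hc
    · rw [max_eq_right hc]
      simpa using sq_nonneg (empiricalDist D h s a₁ - M.stateOccupancy πE h s)
    · rw [max_eq_left hc]
  refine (datasetExp_mono fun D _ => h1 D).trans ?_
  calc M.datasetExp πE (fun D : Dataset S A H N => Fintype.card S *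
        ∑ s ∈ good, (empiricalDist D h s a₁ - M.occupancy πE h s a₁) ^ 2)
      = Fintype.card S * ∑ s ∈ good, M.datasetExp πE (fun D : Dataset S A H N =>
        (empiricalDist D h s a₁ - M.occupancy πE h s a₁) ^ 2) := by
        simp only [datasetExp]
        rw [sum_comm, mul_sum]
        refine sum_congr rfl fun D _ => ?_
        rw [← mul_sum]
        ring
    _ ≤ Fintype.card S * ∑ s ∈ good, M.occupancy πE h s a₁ / N :=
        mul_le_mul_of_nonneg_left (sum_le_sum fun s _ =>
          datasetExp_empiricalDist_sub_sq_le hN M πE h s a₁) (Nat.cast_nonneg _)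
    _ = Fintype.card S / N := by
        rw [← sum_div, sum_congr rfl hocc, hM.sum_good_stateOccupancy, mul_one_div]

theorem datasetExp_sum_max_le_one (hM : M.IsRBAS πE good a₁) (hN : 1 ≤ N) (h : Fin H) :
    M.datasetExp πE (fun D : Dataset S A H N =>
      ∑ s ∈ good, max (empiricalDist D h s a₁ - M.stateOccupancy πE h s) 0) ≤ 1 := by
  refine (datasetExp_mono (g := fun _ => 1) fun D hD => ?_).trans_eq ?_
  · rw [← hM.sum_good_empiricalDist hN hD h]
    exact sum_le_sum fun s _ => max_le (sub_le_self _ (M.stateOccupancy_nonneg πE h s))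
      (empiricalDist_nonneg D h s a₁)
  · simp only [datasetExp, mul_one, M.sum_datasetProb πE h]

end IsRBAS

end TabularMDP

end

theorem mainTheorem3 :
    ∃ C : ℝ, 0 < C ∧
      ∀ (S A : Type*) [Fintype S] [DecidableEq S] [Fintype A] [DecidableEq A]
        (H N : ℕ) (_hH : 2 ≤ H) (_hN : 1 ≤ N)
        (M : TabularMDP S A H) (πE : Policy S A H) (good : Finset S) (a₁ : A)
        (_hM : M.IsRBAS πE good a₁)
        (ε : ℝ) (πbar : Dataset S A H N → Policy S A H)
        (_hcand : ∀ D, 0 < M.datasetProb πE D → TabularMDP.IsCandidate good a₁ (πbar D))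
        (_hopt : ∀ D, 0 < M.datasetProb πE D → M.IsEpsOptimal D ε (πbar D)),
        (∀ D, 0 < M.datasetProb πE D → 0 < M.minVisitProb good a₁ (πbar D)) ∧
        M.value πE - M.datasetExp πE (fun D => M.value (πbar D)) ≤
          C * min
            (1 + M.datasetExp πE (fun D => 8 * ε / M.minVisitProb good a₁ (πbar D)))
            (√((Fintype.card S : ℝ) / N) +
              M.datasetExp πE (fun D => 8 * ε / M.minVisitProb good a₁ (πbar D))) := by
  refine ⟨1, one_pos, ?_⟩
  intro S A _ _ _ _ H N hH hN M πE good a₁ hM ε πbar hcand hopt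
  refine ⟨fun D hD => hM.minVisitProb_pos hH (hcand D hD), ?_⟩
  -- The last step, the only one whose statistical error enters the gap.
  let h : Fin H := ⟨H - 1, by omega⟩
  have h1 := TabularMDP.datasetExp_mono (M := M) (πE := πE) fun D hD =>
    hM.value_sub_le hH hN hD (hcand D hD) (hopt D hD)
  have h2 : M.datasetExp πE (fun D => M.value πE - M.value (πbar D)) =
      M.value πE - M.datasetExp πE (fun D => M.value (πbar D)) := by
    simp only [TabularMDP.datasetExp, mul_sub, sum_sub_distrib, ← sum_mul,
      M.sum_datasetProb πE h, one_mul]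
  rw [h2] at h1
  have h3 : ∀ f g : Dataset S A H N → ℝ, M.datasetExp πE (fun D => f D + g D) =
      M.datasetExp πE f + M.datasetExp πE g := fun f g => by
    simp only [TabularMDP.datasetExp, mul_add, sum_add_distrib]
  rw [h3] at h1
  rw [one_mul]
  exact le_min (h1.trans (add_le_add (hM.datasetExp_sum_max_le_one hN h) le_rfl))
    (h1.trans (add_le_add (hM.datasetExp_sum_max_le_sqrt hN h) le_rfl))
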